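/- Let $n\ge 2$ and $l\ge 1$. Every node $i$ of the complete graph $K_n$ has measurements $X_i\in\{0,\dots,l-1\}$, and all nodes want to compute, with zero error, the sum-threshold function $\Pi_\theta(X_1,\dots,X_n)$, which is $1$ if $X_1+\dots+X_n\ge\theta$ and $0$ otherwise ($\theta\ge 0$ an integer), on blocks of $B$ instances. A block strategy on a network is a deterministic interactive protocol: in each time slot, on each edge, one of the two endpoints sends one bit or the edge is idle, which of these happens being determined by the previous transmissions on that edge; the bit that a node sends depends on its own block of measurements and on the previous transmissions on its edges; at the end every node recovers all $B$ function values from its own measurements and the transmissions it has heard. A rate vector $(R_e)_e$ is achievable on a spanning tree $T$ if for every $\varepsilon>0$ and all sufficiently large $B$ there is a block strategy that uses only edges of $T$ and whose worst-case number of bits on each edge $e$ is at most $B(R_e+\varepsilon)$ (so $R_e\ge 0$ is the only condition for $e\notin T$). Let $R_{ach}$ be the infimum of all $r$ such that the vector with $r$ on every edge of $K_n$ lies in the convex hull of the union, over all spanning trees $T$, of the sets of rate vectors achievable on $T$ (time-sharing of aggregation along trees). For nonempty $A\subsetneq V$ let $C(A)$ be the two-node complexity $\lim_{B\to\infty}\frac1B\min(\text{worst-case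 number of bits})$ over block strategies for two nodes, joined by one edge, which have measurements in $\{0,\dots,|A|(l-1)\}$ and $\{0,\dots,(n-|A|)(l-1)\}$ and both compute $\Pi_\theta$ of their sum. Let $R_{cut}$ be the least $r$ that satisfies all cut-set constraints $|A|(n-|A|)\,r\ge C(A)$, $\emptyset\ne A\subsetneq V$. Then the infimum $R_{ach}$ is taken over a nonempty set of reals that is bounded below, the minimum $R_{cut}$ is attained, and $$R_{ach}\le 2\left(1-\frac1n\right)R_{cut}.$$ The ratio is tight: for all $n\ge 2$ and $l\ge 2$ there is a threshold $\theta$ with $R_{cut}>0$ and $R_{ach}=2\left(1-\frac1n\right)R_{cut}$. -/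

import Mathlib

open Filter Topology

noncomputable section

namespace SumThreshold

variable {V : Type*} [Fintype V] [DecidableEq V]

/-- What has been sent along one edge so far, most recent time slot first. An entry `some b` says
that one bit, `b`, crossed the edge in that slot; `none` says that the edge was idle. All edges
share one clock, so the length of a history is the number of elapsed slots. -/
abbrev History : Type := List (Option Bool)

/-- A block of `B` measurements for every node; the measurements of node `v` lie in
`{0, 1, …, m v}`. -/
abbrev Input (m : V → ℕ) (B : ℕ) : Type _ := (v : V) → Fin B → Fin (m v + 1)

/-- A (deterministic, interactive) block strategy on the network `G`. In every time slot and on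
every edge, one of the two endpoints sends a bit, or neither does. Which of the three happens is
determined by the previous transmissions on that edge (for two nodes joined by an edge, these are
the transmissions that both of them have heard), so that silence carries no information. The bit
that a node sends depends on its own block of measurements and on all previous transmissions on
the edges at that node. After the last slot every node produces a block of values from its own
measurements and the transmissions it has heard. -/
structure Strategy (G : SimpleGraph V) (m : V → ℕ) (B : ℕ) where
  rounds : ℕ
  speaker : Sym2 V → History → Option V
  speaker_mem : ∀ e h v, speaker e h = some v → e ∈ G.edgeSet ∧ v ∈ e
  send : (v : V) → Sym2 V → (Fin B → Fin (m v + 1)) → (V → History) → Bool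
  decode : (v : V) → (Fin B → Fin (m v + 1)) → (V → History) → Fin B → Bool

namespace Strategy

variable {G : SimpleGraph V} {m : V → ℕ} {B : ℕ}

/-- The history of each edge after `t` slots, when the strategy is run on the input `x`. Node `v`
sees the histories of the edges `s(v, u)` only. -/
def hist (S : Strategy G m B) (x : Input m B) : ℕ → Sym2 V → History
  | 0 => fun _ => []
  | t + 1 => fun e =>
      ((S.speaker e (S.hist x t e)).map fun v =>
        S.send v e (x v) fun u => S.hist x t s(v, u)) :: S.hist x t e

/-- Zero-error block computation: on every input, every node obtains, for every instance `k` of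
the block, the value of the sum-threshold function with threshold `θ`. -/
def Computes (S : Strategy G m B) (θ : ℕ) : Prop :=
  ∀ (x : Input m B) (v : V) (k : Fin B),
    S.decode v (x v) (fun u => S.hist x S.rounds s(v, u)) k
      = decide (θ ≤ ∑ i, (x i k : ℕ))

/-- The number of bits exchanged along the edge `e` on the input `x`. -/
def bits (S : Strategy G m B) (x : Input m B) (e : Sym2 V) : ℕ :=
  (S.hist x S.rounds e).countP Option.isSome

/-- The worst-case number of bits exchanged along the edge `e`. -/
def worstBits (S : Strategy G m B) (e : Sym2 V) : ℕ :=
  Finset.univ.sup fun x : Input m B => S.bits x e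

end Strategy

/-- The two-node problem: two nodes joined by an edge, with measurements in `{0, …, m₁}` and
`{0, …, m₂}`, both wanting the function of threshold `θ`. This is the least worst-case number of
bits for zero-error computation of a block of `B` instances. -/
def twoNodeBits (m₁ m₂ θ B : ℕ) : ℕ :=
  sInf {c | ∃ S : Strategy (⊤ : SimpleGraph (Fin 2)) ![m₁, m₂] B,
    S.Computes θ ∧ S.worstBits s(0, 1) = c}

/-- The worst-case per-instance complexity of the two-node problem: the limit of
`twoNodeBits m₁ m₂ θ B / B` as the block length `B` grows. (The sequence `twoNodeBits m₁ m₂ θ` is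
subadditive in `B`, so that the limit exists and is the upper limit.) -/
def twoNodeComplexity (m₁ m₂ θ : ℕ) : ℝ :=
  limsup (fun B : ℕ => (twoNodeBits m₁ m₂ θ B : ℝ) / B) atTop

/-- The rate vectors (bits per instance on each edge) achievable by block strategies on the
network `T`. A pair that is not an edge of `T` carries no bits; for it the condition says
`0 ≤ R e`. -/
def achievableRates (T : SimpleGraph V) (m : V → ℕ) (θ : ℕ) : Set (Sym2 V → ℝ) :=
  {R | ∀ ε > 0, ∀ᶠ B : ℕ in atTop, ∃ S : Strategy T m B,
    S.Computes θ ∧ ∀ e, (S.worstBits e : ℝ) ≤ B * (R e + ε)}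

/-- The rate vectors achievable in `G` by time-sharing between strategies each of which uses the
edges of one spanning tree of `G` only. -/
def treeRates (G : SimpleGraph V) (m : V → ℕ) (θ : ℕ) : Set (Sym2 V → ℝ) :=
  convexHull ℝ (⋃ T ∈ {T : SimpleGraph V | T ≤ G ∧ T.IsTree}, achievableRates T m θ)

open Classical in
/-- The rate vectors that satisfy all cut-set constraints: for every partition of the nodes into
two nonempty parts `A` and `Aᶜ`, the rates of the edges between the parts sum up to at least the
complexity of the two-node problem in which each part is merged into one node. -/
def cutSetRates (G : SimpleGraph V) (m : V → ℕ) (θ : ℕ) : Set (Sym2 V → ℝ) :=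
  {R | ∀ A : Finset V, A.Nonempty → Aᶜ.Nonempty →
    twoNodeComplexity (∑ i ∈ A, m i) (∑ i ∈ Aᶜ, m i) θ
      ≤ ∑ a ∈ A, ∑ b ∈ Aᶜ, if G.Adj a b then R s(a, b) else 0}

/-- The values `r` such that the region contains a rate vector with rate `r` on every edge. -/
def symmetricRates (G : SimpleGraph V) (region : Set (Sym2 V → ℝ)) : Set ℝ :=
  {r | ∃ R ∈ region, ∀ e ∈ G.edgeSet, R e = r}

/-- Best symmetric rate of aggregation along spanning trees. -/
def Rach (G : SimpleGraph V) (m : V → ℕ) (θ : ℕ) : ℝ :=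
  sInf (symmetricRates G (treeRates G m θ))

/-- Least symmetric rate that satisfies the cut-set constraints. -/
def Rcut (G : SimpleGraph V) (m : V → ℕ) (θ : ℕ) : ℝ :=
  sInf (symmetricRates G (cutSetRates G m θ))

end SumThreshold

end

/-! Two parties with ranges `{0, …, a}` and `{0, …, b}` need exactly `logb 2 N` bits per instance,
where `N = cutSize a b θ` (`twoNodeComplexity_eq`). For the lower bound, pairs summing to `θ` or `θ
- 1` form a fooling set of at least `N` elements, apart from huge `θ`, where `N = 1`. When a single
edge crosses a cut, two inputs with equal transcripts on it can be crossed over without any node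
noticing (`hist_mix`), so fooling inputs have distinct transcripts, and Kraft's inequality gives `N
^ B ≤ 2 ^ w` (`cutSize_pow_le`). For the upper bound, one party announces its measurement, with all
values that force 1 merged into one symbol and all values that force 0 into another. The remaining
symbols each cost one reply bit, so they get weight 2, and the weights sum to at most `N`. Words
that need many replies get short codewords, which makes codeword plus replies cost at most `B * logb
2 N + O(log B)` bits (`exists_prefixFree`).

The same code runs on all edges of a star at once, because merged measurements suffice for the
center (`le_sum_clip_iff`). With equal ranges every star edge has the same rate `L`. Each edge of
the complete graph lies in two of the `n` stars, so equal time-sharing gives rate `2 L / n`, while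
singleton cuts force `L ≤ (n - 1) Rcut`. This is the inequality.

For tightness take `θ = 1`. Every cut then has complexity `logb 2 3`, and singleton cuts are crossed
by the fewest edges, so `(n - 1) Rcut = logb 2 3`. Each edge of a spanning tree is alone in some cut
and carries rate at least `logb 2 3`. The resulting bound on the total rate is linear, so it
survives time-sharing and forces rate `2 logb 2 3 / n`. -/

noncomputable section

set_option linter.unusedSectionVars false

namespace SumThreshold

variable {V : Type*} [Fintype V] [DecidableEq V]

/-! ### Counting fooling pairs for the two-node problem -/

/-- The exponential of the complexity of the two-node problem with measurements in `{0, …, a}` and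
`{0, …, b}`. -/
def cutSize (a b θ : ℕ) : ℕ :=
  2 * ((Finset.range (a + 1)).filter fun s => s < θ ∧ θ ≤ s + b).card
    + (if θ ≤ a then 1 else 0) + (if b < θ then 1 else 0)

lemma cutSize_pos (a b θ : ℕ) : 0 < cutSize a b θ := by
  unfold cutSize
  by_cases h1 : θ ≤ a
  · simp [h1]
  by_cases h2 : b < θ
  · simp [h2]
  have : 0 < ((Finset.range (a + 1)).filter fun s => s < θ ∧ θ ≤ s + b).card :=
    Finset.card_pos.2 ⟨0, by simp; omega⟩
  omega

lemma cutSize_one {a b : ℕ} (ha : 1 ≤ a) (hb : 1 ≤ b) : cutSize a b 1 = 3 := by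
  have : ((Finset.range (a + 1)).filter fun s => s < 1 ∧ 1 ≤ s + b) = {0} := by
    ext s; simp; omega
  rw [cutSize, this]; simp [ha, show b ≠ 0 by omega]

lemma cutSize_eq_one_of_lt {a b θ : ℕ} (h : a + b + 1 < θ) : cutSize a b θ = 1 := by
  have : ((Finset.range (a + 1)).filter fun s => s < θ ∧ θ ≤ s + b) = ∅ := by
    ext s; simp; omega
  simp [cutSize, this, show ¬ θ ≤ a by omega, show b < θ by omega]

/-- The pairs of measurements at which the threshold is just met or just missed. -/
def foolingSet (a b θ : ℕ) : Finset (ℕ × ℕ) :=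
  (Finset.range (a + 1) ×ˢ Finset.range (b + 1)).filter fun p =>
    p.1 + p.2 = θ ∨ p.1 + p.2 + 1 = θ

/-- Each unsettled `s` is the first entry of two pairs, one just meeting and one just missing the
threshold. The extreme pairs `(θ, 0)` and `(θ - 1 - b, b)` account for the two indicators; the
hypothesis ensures `θ - 1 - b ≤ a`. -/
lemma cutSize_le_card_foolingSet {a b θ : ℕ} (h : θ ≤ a + b + 1) :
    cutSize a b θ ≤ (foolingSet a b θ).card := by
  set K := (Finset.range (a + 1)).filter fun s => s < θ ∧ θ ≤ s + b with hK
  set P₁ := K.image fun s => (s, θ - s)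
  set P₂ := K.image fun s => (s, θ - 1 - s)
  set P₃ : Finset (ℕ × ℕ) := if θ ≤ a then {(θ, 0)} else ∅
  set P₄ : Finset (ℕ × ℕ) := if b < θ then {(θ - 1 - b, b)} else ∅
  have c₁ : P₁.card = K.card := Finset.card_image_of_injective _ fun _ _ h => (Prod.ext_iff.1 h).1
  have c₂ : P₂.card = K.card := Finset.card_image_of_injective _ fun _ _ h => (Prod.ext_iff.1 h).1
  have c₃ : P₃.card = if θ ≤ a then 1 else 0 := by simp only [P₃]; split_ifs <;> simp
  have c₄ : P₄.card = if b < θ then 1 else 0 := by simp only [P₄]; split_ifs <;> simp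
  have m₁ : ∀ p ∈ P₁, p.1 ≤ a ∧ p.1 < θ ∧ θ ≤ p.1 + b ∧ p.2 = θ - p.1 := by
    simp only [P₁, Finset.mem_image, hK, Finset.mem_filter, Finset.mem_range]
    rintro _ ⟨s, hs, rfl⟩
    dsimp only; omega
  have m₂ : ∀ p ∈ P₂, p.1 ≤ a ∧ p.1 < θ ∧ θ ≤ p.1 + b ∧ p.2 = θ - 1 - p.1 := by
    simp only [P₂, Finset.mem_image, hK, Finset.mem_filter, Finset.mem_range]
    rintro _ ⟨s, hs, rfl⟩
    dsimp only; omega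
  have m₃ : ∀ p ∈ P₃, θ ≤ a ∧ p.1 = θ ∧ p.2 = 0 := by
    intro p hp
    simp only [P₃] at hp
    split_ifs at hp with h'
    · simp at hp; simp [hp, h']
    · simp at hp
  have m₄ : ∀ p ∈ P₄, b < θ ∧ p.1 = θ - 1 - b ∧ p.2 = b := by
    intro p hp
    simp only [P₄] at hp
    split_ifs at hp with h'
    · simp at hp; simp [hp, h']
    · simp at hp
  have d₁ : Disjoint P₁ P₂ := Finset.disjoint_left.2 fun p hp hq => by
    have := m₁ p hp; have := m₂ p hq; omega
  have d₂ : Disjoint (P₁ ∪ P₂) P₃ := Finset.disjoint_left.2 fun p hp hq => by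
    have := m₃ p hq
    rcases Finset.mem_union.1 hp with hp | hp
    · have := m₁ p hp; omega
    · have := m₂ p hp; omega
  have d₃ : Disjoint (P₁ ∪ P₂ ∪ P₃) P₄ := Finset.disjoint_left.2 fun p hp hq => by
    have := m₄ p hq
    rcases Finset.mem_union.1 hp with hp | hp
    · rcases Finset.mem_union.1 hp with hp | hp
      · have := m₁ p hp; omega
      · have := m₂ p hp; omega
    · have := m₃ p hp; omega
  have hsub : P₁ ∪ P₂ ∪ P₃ ∪ P₄ ⊆ foolingSet a b θ := by
    intro p hp
    simp only [foolingSet, Finset.mem_filter, Finset.mem_product, Finset.mem_range]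
    simp only [Finset.mem_union] at hp
    rcases hp with ((hp | hp) | hp) | hp
    · have := m₁ p hp; omega
    · have := m₂ p hp; omega
    · have := m₃ p hp; omega
    · have := m₄ p hp; omega
  refine le_trans ?_ (Finset.card_le_card hsub)
  rw [Finset.card_union_of_disjoint d₃, Finset.card_union_of_disjoint d₂,
    Finset.card_union_of_disjoint d₁, c₁, c₂, c₃, c₄, cutSize, ← hK]
  omega

/-- The two crossed sums have the same total as the two original sums. If all four lie on the same
side of the threshold, the crossed sums can only be `θ` and `θ`, or `θ - 1` and `θ - 1`. -/
lemma eq_of_mem_foolingSet {a b θ : ℕ} {p q : ℕ × ℕ} (hp : p ∈ foolingSet a b θ)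
    (hq : q ∈ foolingSet a b θ) (_h : θ ≤ p.1 + p.2 ↔ θ ≤ q.1 + q.2)
    (h₁ : θ ≤ p.1 + q.2 ↔ θ ≤ p.1 + p.2) (h₂ : θ ≤ q.1 + p.2 ↔ θ ≤ p.1 + p.2) : p = q := by
  simp only [foolingSet, Finset.mem_filter, Finset.mem_product, Finset.mem_range] at hp hq
  ext <;> omega

/-- Lets a measurement of the merged node be distributed over the nodes of `A`. -/
lemma exists_le_sum_eq (m : V → ℕ) (A : Finset V) {k : ℕ} (hk : k ≤ ∑ i ∈ A, m i) :
    ∃ f : V → ℕ, (∀ i, f i ≤ m i) ∧ ∑ i ∈ A, f i = k := by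
  induction A using Finset.induction_on generalizing k with
  | empty => exact ⟨0, by simp, by simp at hk; simp [hk]⟩
  | insert a A ha ih =>
    rw [Finset.sum_insert ha] at hk
    obtain ⟨f, hf, hs⟩ := ih (k := k - m a) (by omega)
    -- Greedy filling: with truncated subtraction, `min k (m a) + (k - m a) = k`.
    refine ⟨Function.update f a (min k (m a)), fun i => ?_, ?_⟩
    · by_cases hi : i = a
      · subst hi; simp
      · simpa [hi] using hf i
    · rw [Finset.sum_insert ha, Finset.sum_congr rfl fun i hi => Function.update_of_ne
        (ne_of_mem_of_not_mem hi ha) _ _, hs]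
      simp; omega

/-! ### Lower bound: Kraft's inequality and crossing over of inputs -/

namespace Strategy

variable {G : SimpleGraph V} {m : V → ℕ} {B : ℕ}

/-- The histories of the edge `e` that the speaking rule of the strategy allows. -/
def histories (S : Strategy G m B) (e : Sym2 V) : ℕ → Finset History
  | 0 => {[]}
  | t + 1 => (S.histories e t).biUnion fun h =>
      if S.speaker e h = none then {none :: h} else {some true :: h, some false :: h}

lemma hist_mem_histories (S : Strategy G m B) (x : Input m B) (e : Sym2 V) (t : ℕ) :
    S.hist x t e ∈ S.histories e t := by
  induction t with
  | zero => simp [hist, histories]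
  | succ t ih =>
    refine Finset.mem_biUnion.2 ⟨_, ih, ?_⟩
    cases h : S.speaker e (S.hist x t e) with
    | none => simp [hist, h]
    | some v =>
      cases h' : S.send v e (x v) fun u => S.hist x t s(v, u) <;> simp [hist, h, h']

/-- Kraft's inequality. The speaker depends on the history of the edge alone, so an idle slot keeps
the weight of a history and a bit splits it into two halves. -/
lemma sum_histories_le_one (S : Strategy G m B) (e : Sym2 V) (t : ℕ) :
    ∑ h ∈ S.histories e t, (1 / 2 : ℝ) ^ h.countP Option.isSome ≤ 1 := by
  induction t with
  | zero => simp [histories]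
  | succ t ih =>
    rw [histories, Finset.sum_biUnion]
    · refine le_trans (le_of_eq (Finset.sum_congr rfl fun h _ => ?_)) ih
      split_ifs
      · simp
      · rw [Finset.sum_pair (by simp)]
        simp [pow_succ]; ring
    · intro h _ h' _ hne
      refine Finset.disjoint_left.2 fun k hk hk' => hne ?_
      -- A history determines its predecessor, so extensions of different histories are different.
      have key : ∀ g : History, k ∈ (if S.speaker e g = none then ({none :: g} : Finset History)
          else {some true :: g, some false :: g}) → k.tail = g := by
        intro g hg
        split_ifs at hg
        · simp at hg; simp [hg]
        · simp at hg; rcases hg with hg | hg <;> simp [hg]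
      rw [← key h hk, ← key h' hk']

lemma card_le_two_pow_worstBits (S : Strategy G m B) (e : Sym2 V) {ι : Type*} [Fintype ι]
    (X : ι → Input m B) (hX : Function.Injective fun i => S.hist (X i) S.rounds e) :
    Fintype.card ι ≤ 2 ^ S.worstBits e := by
  have h₁ : ∑ i : ι, (1 / 2 : ℝ) ^ S.bits (X i) e ≤ 1 := by
    refine le_trans ?_ (S.sum_histories_le_one e S.rounds)
    have := Finset.sum_image (s := Finset.univ)
      (f := fun h : History => (1 / 2 : ℝ) ^ h.countP Option.isSome)
      (g := fun i => S.hist (X i) S.rounds e) (fun i _ j _ h => hX h)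
    simp only [bits]
    rw [← this]
    refine Finset.sum_le_sum_of_subset_of_nonneg ?_ fun _ _ _ => by positivity
    intro h hh
    obtain ⟨i, -, rfl⟩ := Finset.mem_image.1 hh
    exact S.hist_mem_histories _ _ _
  have h₂ : ∀ i, (1 / 2 : ℝ) ^ S.worstBits e ≤ (1 / 2 : ℝ) ^ S.bits (X i) e := fun i =>
    pow_le_pow_of_le_one (by norm_num) (by norm_num)
      (Finset.le_sup (f := fun x => S.bits x e) (Finset.mem_univ (X i)))
  have h₃ := (Finset.sum_le_sum fun i (_ : i ∈ Finset.univ) => h₂ i).trans h₁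
  rw [Finset.sum_const, nsmul_eq_mul, Finset.card_univ, one_div, inv_pow] at h₃
  rw [← div_eq_mul_inv, div_le_one (by positivity)] at h₃
  exact_mod_cast h₃

/-- The input that agrees with `x` on `A` and with `y` off `A`. -/
def mix (A : Finset V) (x y : Input m B) : Input m B := fun v => if v ∈ A then x v else y v

lemma hist_eq_of_hist_eq (S : Strategy G m B) {x y : Input m B} {e : Sym2 V} {t : ℕ}
    (h : S.hist x (t + 1) e = S.hist y (t + 1) e) : S.hist x t e = S.hist y t e := by
  simpa [hist] using (List.cons_eq_cons.1 h).2

/-- The nodes of `A` cannot distinguish the mixed input from `x`, nor the others from `y`, since the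
sides communicate only through `e`, where both runs agree. -/
lemma hist_mix (S : Strategy G m B) {A : Finset V} {e : Sym2 V}
    (hcut : ∀ a ∈ A, ∀ b ∉ A, G.Adj a b → s(a, b) = e) {x y : Input m B} (t : ℕ)
    (he : S.hist x t e = S.hist y t e) :
    (∀ a ∈ A, ∀ u, S.hist (mix A x y) t s(a, u) = S.hist x t s(a, u)) ∧
      ∀ b ∉ A, ∀ u, S.hist (mix A x y) t s(b, u) = S.hist y t s(b, u) := by
  induction t with
  | zero => simp [hist]
  | succ t ih =>
    have he' := S.hist_eq_of_hist_eq he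
    obtain ⟨ihA, ihB⟩ := ih he'
    have sendA : ∀ a ∈ A, ∀ f, (S.send a f (mix A x y a) fun u => S.hist (mix A x y) t s(a, u))
        = S.send a f (x a) fun u => S.hist x t s(a, u) := fun a ha f => by
      simp only [ihA a ha]; simp [mix, ha]
    have sendB : ∀ b ∉ A, ∀ f, (S.send b f (mix A x y b) fun u => S.hist (mix A x y) t s(b, u))
        = S.send b f (y b) fun u => S.hist y t s(b, u) := fun b hb f => by
      simp only [ihB b hb]; simp [mix, hb]
    have hbit := (List.cons_eq_cons.1 he).1
    rw [he'] at hbit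
    constructor
    · intro a ha u
      simp only [hist, ihA a ha u]
      congr 1
      cases hs : S.speaker s(a, u) (S.hist x t s(a, u)) with
      | none => rfl
      | some v =>
        simp only [Option.map_some]
        congr 1
        obtain ⟨hG, hv⟩ := S.speaker_mem _ _ _ hs
        by_cases hvA : v ∈ A
        · exact sendA v hvA _
        -- A speaker off `A` on an edge at `A` forces the edge to be `e`. It sends the bit of the
        -- run on `y`, which `hbit` identifies with the bit of the run on `x`.
        · have hvu : v = u := by
            rcases Sym2.mem_iff.1 hv with rfl | h
            · exact absurd ha hvA
            · exact h
          subst hvu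
          have hae := hcut a ha v hvA hG
          rw [sendB v hvA, hae]
          rw [hae] at hs
          rw [← he', hs] at hbit
          simpa using hbit.symm
    · intro b hb u
      simp only [hist, ihB b hb u]
      congr 1
      cases hs : S.speaker s(b, u) (S.hist y t s(b, u)) with
      | none => rfl
      | some v =>
        simp only [Option.map_some]
        congr 1
        obtain ⟨hG, hv⟩ := S.speaker_mem _ _ _ hs
        by_cases hvA : v ∈ A
        · have hvu : v = u := by
            rcases Sym2.mem_iff.1 hv with rfl | h
            · exact absurd hvA hb
            · exact h
          subst hvu
          have hae := hcut v hvA b hb (G.adj_symm hG)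
          rw [Sym2.eq_swap] at hae
          rw [sendA v hvA, hae]
          rw [hae] at hs
          rw [hs] at hbit
          simpa using hbit
        · exact sendB v hvA _

lemma value_mix (S : Strategy G m B) {θ : ℕ} (hS : S.Computes θ) {A : Finset V} {e : Sym2 V}
    (hcut : ∀ a ∈ A, ∀ b ∉ A, G.Adj a b → s(a, b) = e) {u w : V} (hu : u ∈ A) (hw : w ∉ A)
    {x y : Input m B} (he : S.hist x S.rounds e = S.hist y S.rounds e) (k : Fin B) :
    (θ ≤ ∑ i, (mix A x y i k : ℕ) ↔ θ ≤ ∑ i, (x i k : ℕ)) ∧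
      (θ ≤ ∑ i, (mix A x y i k : ℕ) ↔ θ ≤ ∑ i, (y i k : ℕ)) := by
  obtain ⟨hA, hB⟩ := S.hist_mix hcut S.rounds he
  constructor
  · have h₁ := hS (mix A x y) u k
    have h₂ := hS x u k
    simp only [hA u hu] at h₁
    rw [show mix A x y u = x u by simp [mix, hu], h₂] at h₁
    simpa using h₁.symm
  · have h₁ := hS (mix A x y) w k
    have h₂ := hS y w k
    simp only [hB w hw] at h₁
    rw [show mix A x y w = y w by simp [mix, hw], h₂] at h₁
    simpa using h₁.symm

/-- The cut-set lower bound on the number of bits that cross an edge. -/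
theorem cutSize_pow_le (S : Strategy G m B) {θ : ℕ} (hS : S.Computes θ) {A : Finset V}
    {e : Sym2 V} (hcut : ∀ a ∈ A, ∀ b ∉ A, G.Adj a b → s(a, b) = e) {u w : V} (hu : u ∈ A)
    (hw : w ∉ A) :
    cutSize (∑ i ∈ A, m i) (∑ i ∈ Aᶜ, m i) θ ^ B ≤ 2 ^ S.worstBits e := by
  set a := ∑ i ∈ A, m i
  set b := ∑ i ∈ Aᶜ, m i
  by_cases hθ : a + b + 1 < θ
  -- Here the fooling set is empty, but the bound is trivial.
  · rw [cutSize_eq_one_of_lt hθ]; simpa using Nat.one_le_two_pow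
  choose f hfm hf using fun s : Fin (a + 1) => exists_le_sum_eq m A (Nat.lt_succ_iff.1 s.2)
  choose g hgm hg using fun s : Fin (b + 1) => exists_le_sum_eq m Aᶜ (Nat.lt_succ_iff.1 s.2)
  have hF : ∀ p : foolingSet a b θ, p.1.1 < a + 1 ∧ p.1.2 < b + 1 := fun p => by
    have := p.2
    simp only [foolingSet, Finset.mem_filter, Finset.mem_product, Finset.mem_range] at this
    exact this.1
  let X : (Fin B → foolingSet a b θ) → Input m B := fun p v k =>
    if v ∈ A then ⟨f ⟨_, (hF (p k)).1⟩ v, Nat.lt_succ_of_le (hfm _ v)⟩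
    else ⟨g ⟨_, (hF (p k)).2⟩ v, Nat.lt_succ_of_le (hgm _ v)⟩
  have hmix : ∀ p q k, ∑ i, (mix A (X p) (X q) i k : ℕ) = (p k).1.1 + (q k).1.2 := by
    intro p q k
    rw [← Finset.sum_add_sum_compl A]
    congr 1
    · refine Eq.trans ?_ (hf ⟨_, (hF (p k)).1⟩)
      exact Finset.sum_congr rfl fun i hi => by simp [mix, X, hi]
    · refine Eq.trans ?_ (hg ⟨_, (hF (q k)).2⟩)
      exact Finset.sum_congr rfl fun i hi => by simp [mix, X, Finset.mem_compl.1 hi]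
  have hsum : ∀ p k, ∑ i, (X p i k : ℕ) = (p k).1.1 + (p k).1.2 := by
    intro p k
    rw [← hmix p p k]
    exact Finset.sum_congr rfl fun i _ => by simp [mix]
  have hinj : Function.Injective fun p => S.hist (X p) S.rounds e := by
    intro p q hpq
    funext k
    have h₁ := S.value_mix hS hcut hu hw hpq k
    have h₂ := S.value_mix hS hcut hu hw hpq.symm k
    simp only [hmix, hsum] at h₁ h₂
    exact Subtype.ext (eq_of_mem_foolingSet (p k).2 (q k).2 (by tauto) (by tauto) (by tauto))
  have := S.card_le_two_pow_worstBits e X hinj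
  rw [Fintype.card_fun, Fintype.card_coe, Fintype.card_fin] at this
  exact (Nat.pow_le_pow_left (cutSize_le_card_foolingSet (by omega)) B).trans this

end Strategy

/-! ### Prefix-free block codes -/

lemma two_pow_clog_le {n : ℕ} (hn : 1 ≤ n) : 2 ^ Nat.clog 2 n ≤ 2 * n := by
  rcases hn.eq_or_lt with rfl | h
  · simp
  · have h₁ := Nat.pow_pred_clog_lt_self Nat.one_lt_two h
    have h₂ : 0 < Nat.clog 2 n := Nat.clog_pos Nat.one_lt_two h
    calc 2 ^ Nat.clog 2 n = 2 * 2 ^ (Nat.clog 2 n).pred := by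
          rw [← pow_succ', Nat.pred_eq_sub_one, Nat.sub_add_cancel h₂]
      _ ≤ 2 * n := by omega

lemma exists_injective_bits (α : Type*) [Fintype α] :
    ∃ f : α → List Bool, Function.Injective f ∧
      ∀ a, (f a).length = Nat.clog 2 (Fintype.card α) := by
  have : Fintype.card α ≤ Fintype.card (List.Vector Bool (Nat.clog 2 (Fintype.card α))) := by
    rw [card_vector, Fintype.card_bool]
    exact Nat.le_pow_clog Nat.one_lt_two _
  obtain ⟨f⟩ := Function.Embedding.nonempty_of_card_le this
  exact ⟨fun a => (f a).1, fun _ _ h => f.injective (Subtype.ext h), fun a => (f a).2⟩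

/-- A block code none of whose codewords is a prefix of another one. -/
def PrefixFree {W : Type*} (enc : W → List Bool) : Prop :=
  ∀ w w', enc w <+: enc w' → w = w'

/-- A prefix-free code in which every word `w`, followed by `r w` more bits, is about as long as
if all words had the same total length. -/
theorem exists_prefixFree {W : Type*} [Fintype W] (r : W → ℕ) {B M : ℕ} (hr : ∀ w, r w ≤ B)
    (hM : ∑ w, 2 ^ r w ≤ M) :
    ∃ enc : W → List Bool, PrefixFree enc ∧
      ∀ w, 2 ^ ((enc w).length + r w) ≤ 4 * (B + 1) * M := by
  classical
  obtain ⟨f, hf, hfl⟩ := exists_injective_bits (Fin (B + 1))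
  choose g hg hgl using fun k : ℕ => exists_injective_bits {w : W // r w = k}
  -- The codeword names the class `r w`, then the index of `w` within its class. The second length
  -- depends only on the class, so no codeword is a proper prefix of another. The two roundings up
  -- and the class name cost the factor `4 * (B + 1)`.
  refine ⟨fun w => f ⟨r w, Nat.lt_succ_of_le (hr w)⟩ ++ g (r w) ⟨w, rfl⟩, ?_, fun w => ?_⟩
  · rintro w w' ⟨t, ht⟩
    have key : ∀ k k' (h : r w = k) (h' : r w' = k'), k = k' →
        g k ⟨w, h⟩ ++ t = g k' ⟨w', h'⟩ → w = w' := by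
      rintro k _ h h' rfl e
      have hl := congrArg List.length e
      rw [List.length_append, hgl, hgl] at hl
      have : t = [] := List.eq_nil_of_length_eq_zero (by omega)
      rw [this, List.append_nil] at e
      exact congrArg Subtype.val (hg k e)
    rw [List.append_assoc] at ht
    obtain ⟨h₁, h₂⟩ := List.append_inj ht (by rw [hfl, hfl])
    exact key _ _ rfl rfl (congrArg Fin.val (hf h₁)) h₂
  · rw [List.length_append, hfl, hgl, Fintype.card_fin, pow_add, pow_add]
    set n := Fintype.card {w' : W // r w' = r w} with hn
    have hn1 : 1 ≤ n := Fintype.card_pos_iff.2 ⟨⟨w, rfl⟩⟩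
    have hnM : n * 2 ^ r w ≤ M := by
      refine le_trans ?_ hM
      rw [hn, Fintype.card_subtype, ← smul_eq_mul, ← Finset.sum_const]
      refine le_trans (le_of_eq (Finset.sum_congr rfl fun w' hw' => ?_))
        (Finset.sum_le_sum_of_subset (Finset.filter_subset (fun w' => r w' = r w) Finset.univ))
      rw [(Finset.mem_filter.1 hw').2]
    calc 2 ^ Nat.clog 2 (B + 1) * 2 ^ Nat.clog 2 n * 2 ^ r w
        ≤ (2 * (B + 1)) * (2 * n) * 2 ^ r w := by
          gcongr
          · exact two_pow_clog_le (by omega)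
          · exact two_pow_clog_le hn1
      _ = 4 * (B + 1) * (n * 2 ^ r w) := by ring
      _ ≤ 4 * (B + 1) * M := by gcongr

open Classical in
/-- The word whose codeword comes first in the sequence `l`, if there is one. -/
def decodePrefix {W : Type*} (enc : W → List Bool) (l : List Bool) : Option W :=
  if h : ∃ w, enc w <+: l then some h.choose else none

lemma PrefixFree.decodePrefix_eq {W : Type*} {enc : W → List Bool} (h : PrefixFree enc) {w : W}
    {l : List Bool} (hw : enc w <+: l) : decodePrefix enc l = some w := by
  have hex : ∃ w, enc w <+: l := ⟨w, hw⟩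
  rw [decodePrefix, dif_pos hex]
  rcases List.prefix_or_prefix_of_prefix hex.choose_spec hw with h' | h'
  · rw [h _ _ h']
  · rw [← h _ _ h']

/-- Nothing is decoded too early, so both ends of an edge know from its history when the codeword is
complete. -/
lemma PrefixFree.decodePrefix_take {W : Type*} {enc : W → List Bool} (h : PrefixFree enc) {w : W}
    {t : ℕ} (ht : t < (enc w).length) : decodePrefix enc ((enc w).take t) = none := by
  rw [decodePrefix, dif_neg]
  rintro ⟨w', hw'⟩
  have := h _ _ (hw'.trans (List.take_prefix _ _))
  subst this
  have := hw'.length_le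
  rw [List.length_take] at this
  omega

/-! ### Clipped measurements and their weights -/

/-- A measurement `s` that does not settle the value of the function when the other measurements
sum up to at most `b`. -/
def Unsettled (b θ s : ℕ) : Prop := s < θ ∧ θ ≤ s + b

instance (b θ s : ℕ) : Decidable (Unsettled b θ s) := by unfold Unsettled; infer_instance

/-- What a node has to tell about its measurement `s` when the other measurements sum up to at
most `b`. -/
def clip (b θ s : ℕ) : ℕ := if θ ≤ s then θ else if s + b < θ then 0 else s

/-- The values of `clip` on `{0, …, a}`. -/
def alphabet (a b θ : ℕ) : Finset ℕ :=
  ((Finset.range (a + 1)).filter fun s => s < θ ∧ θ ≤ s + b)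
    ∪ (if θ ≤ a then {θ} else ∅) ∪ (if b < θ then {0} else ∅)

lemma clip_mem_alphabet {a b θ s : ℕ} (hs : s ≤ a) : clip b θ s ∈ alphabet a b θ := by
  unfold clip alphabet
  simp only [Finset.mem_union, Finset.mem_filter, Finset.mem_range]
  split_ifs <;> simp <;> omega

lemma clip_le (b θ s : ℕ) : clip b θ s ≤ s := by
  unfold clip; split_ifs <;> omega

lemma unsettled_clip {b θ s : ℕ} : Unsettled b θ (clip b θ s) ↔ Unsettled b θ s := by
  unfold Unsettled clip; split_ifs <;> omega

lemma sum_alphabet_le (a b θ : ℕ) :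
    ∑ s ∈ alphabet a b θ, 2 ^ (if Unsettled b θ s then 1 else 0) ≤ cutSize a b θ := by
  unfold alphabet cutSize
  set K := (Finset.range (a + 1)).filter fun s => s < θ ∧ θ ≤ s + b
  -- Only an upper bound is needed, so disjointness of the three parts of the alphabet plays no
  -- role.
  have hsub : ∀ (F : ℕ → ℕ) (P Q : Finset ℕ), ∑ s ∈ P ∪ Q, F s ≤ ∑ s ∈ P, F s + ∑ s ∈ Q, F s := by
    intro F P Q
    rw [← Finset.sum_union_inter]; exact Nat.le_add_right _ _
  refine (hsub _ _ _).trans (add_le_add ((hsub _ _ _).trans (add_le_add ?_ ?_)) ?_)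
  · refine le_of_eq ?_
    rw [mul_comm, ← smul_eq_mul, ← Finset.sum_const]
    refine Finset.sum_congr rfl fun s hs => ?_
    rw [if_pos (show Unsettled b θ s from (Finset.mem_filter.1 hs).2), pow_one]
  · split_ifs <;> simp [Unsettled]
  · split_ifs with h
    · rw [Finset.sum_singleton, if_neg (by unfold Unsettled; omega), pow_zero]
    · simp

/-- The number of instances for which the word leaves the value of the function open. -/
def replies {B : ℕ} {a b θ : ℕ} (w : Fin B → alphabet a b θ) : ℕ :=
  (Finset.univ.filter fun k => Unsettled b θ (w k)).card

lemma sum_two_pow_replies_le (a b θ B : ℕ) :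
    ∑ w : Fin B → alphabet a b θ, 2 ^ replies w ≤ cutSize a b θ ^ B := by
  refine le_trans (le_of_eq ?_) (Nat.pow_le_pow_left (sum_alphabet_le a b θ) B)
  rw [← Finset.sum_coe_sort (alphabet a b θ), Fintype.sum_pow]
  refine Finset.sum_congr rfl fun w _ => ?_
  rw [Finset.prod_pow_eq_pow_sum, replies, Finset.card_filter]

lemma exists_prefixFree_alphabet (a b θ B : ℕ) :
    ∃ enc : (Fin B → alphabet a b θ) → List Bool, PrefixFree enc ∧
      ∀ w, 2 ^ ((enc w).length + replies w) ≤ 4 * (B + 1) * cutSize a b θ ^ B :=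
  exists_prefixFree replies (fun w => (Finset.card_filter_le _ _).trans (by simp))
    (sum_two_pow_replies_le a b θ B)

/-- The largest possible sum of the measurements of the other nodes. -/
def others (m : V → ℕ) (v : V) : ℕ := ∑ u ∈ {v}ᶜ, m u

lemma sum_le_add_others {m y : V → ℕ} (hy : ∀ u, y u ≤ m u) (v : V) :
    ∑ u, y u ≤ y v + others m v := by
  rw [← Finset.sum_add_sum_compl {v}, Finset.sum_singleton, others]
  exact Nat.add_le_add_left (Finset.sum_le_sum fun u _ => hy u) _

/-- If some clipped node reaches `θ` alone, it still does so after clipping. If some node rules `θ`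
out, the sum stays below `θ` because clipping never increases a value. Otherwise clipping changes
nothing. -/
lemma le_sum_clip_iff (m x : V → ℕ) (hx : ∀ u, x u ≤ m u) (θ : ℕ) (c : V) :
    (θ ≤ ∑ u, if u = c then x u else clip (others m u) θ (x u)) ↔ θ ≤ ∑ u, x u := by
  obtain ⟨y, hy⟩ : ∃ y : V → ℕ, y = fun u => if u = c then x u else clip (others m u) θ (x u) :=
    ⟨_, rfl⟩
  have hs : (∑ u, if u = c then x u else clip (others m u) θ (x u)) = ∑ u, y u := by rw [hy]
  rw [hs]
  have hyx : ∀ u, y u ≤ x u := fun u => by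
    simp only [hy]; split_ifs
    · exact le_rfl
    · exact clip_le _ _ _
  by_cases h₁ : ∃ u, u ≠ c ∧ θ ≤ x u
  · obtain ⟨u, huc, hu⟩ := h₁
    have hyu : y u = θ := by simp [hy, huc, clip, hu]
    have := Finset.single_le_sum (f := y) (fun i _ => Nat.zero_le _) (Finset.mem_univ u)
    have := Finset.single_le_sum (f := x) (fun i _ => Nat.zero_le _) (Finset.mem_univ u)
    constructor <;> intro <;> omega
  by_cases h₂ : ∃ u, u ≠ c ∧ x u + others m u < θ
  · obtain ⟨u, -, hu⟩ := h₂
    have := sum_le_add_others hx u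
    have := sum_le_add_others (fun i => (hyx i).trans (hx i)) u
    have := hyx u
    constructor <;> intro <;> omega
  push Not at h₁ h₂
  have : y = x := by
    funext u
    simp only [hy]
    split_ifs with h
    · rfl
    · rw [clip, if_neg (h₁ u h).not_ge, if_neg (h₂ u h).not_gt]
  rw [this]

/-! ### Aggregation along a star -/

/-- The bits of a history, in the order in which they were sent. -/
def History.toBits (h : History) : List Bool := h.reverse.reduceOption

/-- The endpoint other than `c` of an edge at `c`, and `c` for other pairs. -/
def leafOf (c : V) (e : Sym2 V) : V :=
  open Classical in if h : ∃ v, e = s(c, v) then h.choose else c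

lemma leafOf_mk (c v : V) : leafOf c s(c, v) = v := by
  have h : ∃ u, s(c, v) = s(c, u) := ⟨v, rfl⟩
  rw [leafOf, dif_pos h]
  exact (Sym2.congr_right.1 h.choose_spec).symm

lemma eq_mk_leafOf {c : V} {e : Sym2 V} (h : leafOf c e ≠ c) : e = s(c, leafOf c e) := by
  unfold leafOf at h ⊢
  split_ifs at h ⊢ with h'
  · exact h'.choose_spec
  · exact absurd rfl h

/-- A block of clipped measurements of the node `v`. -/
abbrev Word (m : V → ℕ) (θ B : ℕ) (v : V) : Type := Fin B → alphabet (m v) (others m v) θ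

/-- The clipped block of measurements. -/
def toWord {m : V → ℕ} {B : ℕ} (θ : ℕ) {v : V} (x : Fin B → Fin (m v + 1)) : Word m θ B v :=
  fun k => ⟨clip (others m v) θ (x k), clip_mem_alphabet (Nat.lt_succ_iff.1 (x k).2)⟩

section Star

variable {m : V → ℕ} {θ B : ℕ}

/-- The function values, as computed by the center `c` of a star from its measurements `x` and
the codewords it has received. -/
def centerValue (enc : ∀ v, Word m θ B v → List Bool) (c : V) (x : Fin B → ℕ) (hs : V → History)
    (k : Fin B) : Bool :=
  decide (θ ≤ ∑ u, if u = c then x k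
    else (decodePrefix (enc u) (hs u).toBits).elim 0 fun w => (w k : ℕ))

open Classical in
/-- Aggregation along the star with center `c`. Every leaf sends a codeword for its clipped
measurements during the first `Q` slots. In slot `Q + k`, the center tells the value of instance
`k` to each leaf whose measurement leaves it open. -/
def starStrategy (enc : ∀ v, Word m θ B v → List Bool) (Q : ℕ) (c : V) :
    Strategy (SimpleGraph.starGraph c) m B where
  rounds := Q + B
  speaker e h :=
    if leafOf c e = c then none
    else if h.length < Q then
      if decodePrefix (enc (leafOf c e)) h.toBits = none then some (leafOf c e) else none
    -- The decoded word is known at both ends, so whether a reply is due is a function of the edge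
    -- history, as the model demands.
    else if ∃ w, decodePrefix (enc (leafOf c e)) h.toBits = some w ∧
        ∃ k : Fin B, h.length = Q + k ∧ Unsettled (others m (leafOf c e)) θ (w k) then some c
    else none
  speaker_mem e h v hv := by
    by_cases h₁ : leafOf c e = c
    · rw [if_pos h₁] at hv; simp at hv
    rw [if_neg h₁] at hv
    have he := eq_mk_leafOf h₁
    have hG : e ∈ (SimpleGraph.starGraph c).edgeSet := by
      rw [he, SimpleGraph.mem_edgeSet]
      exact SimpleGraph.starGraph_center_adj (Ne.symm h₁)
    have hc : c ∈ e := by rw [he]; exact Sym2.mem_mk_left _ _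
    have hl : leafOf c e ∈ e := by
      have := Sym2.mem_mk_right c (leafOf c e)
      rwa [← he] at this
    split_ifs at hv <;> simp at hv <;> subst hv
    · exact ⟨hG, hl⟩
    · exact ⟨hG, hc⟩
  send v e x hs :=
    if v = c then
      if hk : (hs (leafOf c e)).length - Q < B then
        centerValue enc c (fun k => x k) hs ⟨_, hk⟩ else false
    else ((enc v (toWord θ x))[(hs c).length]?).getD false
  decode v x hs k :=
    if v = c then centerValue enc c (fun k => x k) hs k
    else if θ ≤ x k then true
    else if (x k : ℕ) + others m v < θ then false
    -- Histories list the latest slot first; after reversal, `Q + k` is the slot of the reply.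
    else ((hs c).reverse[Q + k]?).join.getD false

/-- What crosses the edge between the center and the leaf `v` of a star in slot `j`. -/
def starSlot (enc : ∀ v, Word m θ B v → List Bool) (Q : ℕ) (x : Input m B) (v : V) (j : ℕ) :
    Option Bool :=
  if j < Q then (enc v (toWord θ (x v)))[j]?
  else if hk : j - Q < B then
    if Unsettled (others m v) θ (toWord θ (x v) ⟨j - Q, hk⟩) then
      some (decide (θ ≤ ∑ i, (x i ⟨j - Q, hk⟩ : ℕ))) else none
  else none

lemma reduceOption_map_getElem? {α : Type*} (l : List α) (t : ℕ) :
    ((List.range t).map fun j => l[j]?).reduceOption = l.take t := by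
  induction t with
  | zero => simp
  | succ t ih =>
    rw [List.range_succ, List.map_append, List.reduceOption_append, ih, List.take_add_one]
    congr 1

/-- The history of a leaf edge of a star after `t` slots. -/
def starHist (enc : ∀ v, Word m θ B v → List Bool) (Q : ℕ) (x : Input m B) (v : V) (t : ℕ) :
    History :=
  ((List.range t).map (starSlot enc Q x v)).reverse

variable {enc : ∀ v, Word m θ B v → List Bool} {Q : ℕ} {c : V} {x : Input m B}

lemma length_starHist (v : V) (t : ℕ) : (starHist enc Q x v t).length = t := by
  simp [starHist]

lemma starHist_succ (v : V) (t : ℕ) :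
    starHist enc Q x v (t + 1) = starSlot enc Q x v t :: starHist enc Q x v t := by
  simp [starHist, List.range_succ]

lemma toBits_starHist_of_le (v : V) {t : ℕ} (ht : t ≤ Q) :
    (starHist enc Q x v t).toBits = (enc v (toWord θ (x v))).take t := by
  rw [starHist, History.toBits, List.reverse_reverse, ← reduceOption_map_getElem?]
  congr 1
  refine List.map_congr_left fun j hj => ?_
  rw [starSlot, if_pos (lt_of_lt_of_le (List.mem_range.1 hj) ht)]

/-- The replies only extend the bit sequence behind the codeword, so decoding remains valid in the
second phase. -/
lemma prefix_toBits_starHist (hQ : ∀ v w, (enc v w).length ≤ Q) (v : V) {t : ℕ} (ht : Q ≤ t) :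
    enc v (toWord θ (x v)) <+: (starHist enc Q x v t).toBits := by
  obtain ⟨s, rfl⟩ := Nat.exists_eq_add_of_le ht
  have h := toBits_starHist_of_le (enc := enc) (x := x) v (le_refl Q)
  rw [List.take_of_length_le (hQ _ _)] at h
  rw [← h]
  simp only [starHist, History.toBits, List.reverse_reverse, List.range_add, List.map_append,
    List.reduceOption_append]
  exact List.prefix_append _ _

lemma decodePrefix_starHist (henc : ∀ v, PrefixFree (enc v)) (hQ : ∀ v w, (enc v w).length ≤ Q)
    (v : V) {t : ℕ} (ht : Q ≤ t) :
    decodePrefix (enc v) (starHist enc Q x v t).toBits = some (toWord θ (x v)) :=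
  (henc v).decodePrefix_eq (prefix_toBits_starHist hQ v ht)

lemma centerValue_starHist (henc : ∀ v, PrefixFree (enc v)) (hQ : ∀ v w, (enc v w).length ≤ Q)
    {t : ℕ} (ht : Q ≤ t) {hs : V → History} (hhs : ∀ u, u ≠ c → hs u = starHist enc Q x u t)
    (k : Fin B) :
    centerValue enc c (fun k => x c k) hs k = decide (θ ≤ ∑ i, (x i k : ℕ)) := by
  rw [centerValue, decide_eq_decide,
    ← le_sum_clip_iff m (fun u => x u k) (fun u => Nat.lt_succ_iff.1 (x u k).2) θ c]
  refine Iff.of_eq (congrArg _ (Finset.sum_congr rfl fun u _ => ?_))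
  split_ifs with hu
  · rw [hu]
  · rw [hhs u hu, decodePrefix_starHist henc hQ u ht]
    rfl

open Classical in
lemma speaker_starStrategy {v : V} (hv : v ≠ c) (h : History) :
    (starStrategy enc Q c).speaker s(c, v) h
      = if h.length < Q then
          if decodePrefix (enc v) h.toBits = none then some v else none
        else if ∃ w, decodePrefix (enc v) h.toBits = some w ∧
          ∃ k : Fin B, h.length = Q + k ∧ Unsettled (others m v) θ (w k) then some c
        else none := by
  simp only [starStrategy]
  have hu : leafOf c s(c, v) = v := leafOf_mk c v
  generalize leafOf c s(c, v) = u at hu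
  subst hu
  rw [if_neg hv]

lemma send_starStrategy_leaf {v : V} (hv : v ≠ c) (e : Sym2 V) (y : Fin B → Fin (m v + 1))
    (hs : V → History) :
    (starStrategy enc Q c).send v e y hs = ((enc v (toWord θ y))[(hs c).length]?).getD false :=
  if_neg hv

lemma hist_starStrategy (henc : ∀ v, PrefixFree (enc v)) (hQ : ∀ v w, (enc v w).length ≤ Q)
    (x : Input m B) (t : ℕ) (v : V) (hv : v ≠ c) :
    (starStrategy enc Q c).hist x t s(c, v) = starHist enc Q x v t := by
  induction t generalizing v with
  | zero => simp [Strategy.hist, starHist]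
  | succ t ih =>
    rw [starHist_succ, Strategy.hist]
    beta_reduce
    rw [ih v hv]
    congr 1
    by_cases ht : t < Q
    · have hsp : (starStrategy enc Q c).speaker s(c, v) (starHist enc Q x v t)
          = if t < (enc v (toWord θ (x v))).length then some v else none := by
        rw [speaker_starStrategy hv, length_starHist, if_pos ht, toBits_starHist_of_le v ht.le]
        by_cases hl : t < (enc v (toWord θ (x v))).length
        · rw [(henc v).decodePrefix_take hl, if_pos rfl, if_pos hl]
        · rw [List.take_of_length_le (not_lt.1 hl), (henc v).decodePrefix_eq List.prefix_rfl,
            if_neg (by simp), if_neg hl]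
      rw [hsp, starSlot, if_pos ht]
      split_ifs with hl
      · have hc : (starStrategy enc Q c).hist x t s(v, c) = starHist enc Q x v t := by
          rw [Sym2.eq_swap]; exact ih v hv
        rw [Option.map_some, send_starStrategy_leaf hv, hc, length_starHist,
          List.getElem?_eq_getElem hl, Option.getD_some]
      · rw [List.getElem?_eq_none (not_lt.1 hl)]; rfl
    · have ht' : Q ≤ t := not_lt.1 ht
      rw [starSlot, if_neg ht]
      have hsp : (starStrategy enc Q c).speaker s(c, v) (starHist enc Q x v t)
          = if ∃ k : Fin B, t = Q + k ∧ Unsettled (others m v) θ (toWord θ (x v) k) then some c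
            else none := by
        rw [speaker_starStrategy hv, length_starHist, if_neg ht]
        simp only [decodePrefix_starHist henc hQ v ht', Option.some.injEq, exists_eq_left']
      rw [hsp]
      by_cases hk : t - Q < B
      · rw [dif_pos hk]
        have hiff : (∃ k : Fin B, t = Q + k ∧ Unsettled (others m v) θ (toWord θ (x v) k)) ↔
            Unsettled (others m v) θ (toWord θ (x v) ⟨t - Q, hk⟩) := by
          constructor
          · rintro ⟨k, hk', hu⟩
            have : k = ⟨t - Q, hk⟩ := Fin.ext (by simp; omega)
            rwa [← this]
          · exact fun hu => ⟨⟨t - Q, hk⟩, by simp; omega, hu⟩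
        rw [if_congr hiff rfl rfl]
        split_ifs with hu
        · have hlen : ((starStrategy enc Q c).hist x t s(c, v)).length = t := by
            rw [ih v hv, length_starHist]
          simp only [Option.map_some, Option.some.injEq]
          simp only [starStrategy] at hlen ih ⊢
          simp only [if_true, leafOf_mk, hlen, dif_pos hk]
          exact centerValue_starHist henc hQ ht' (fun u hu => ih u hu) _
        · rfl
      · rw [dif_neg hk, if_neg]
        · rfl
        · rintro ⟨k, hk', -⟩
          omega

lemma computes_starStrategy (henc : ∀ v, PrefixFree (enc v))
    (hQ : ∀ v w, (enc v w).length ≤ Q) (c : V) : (starStrategy enc Q c).Computes θ := by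
  intro x v k
  by_cases hv : v = c
  · subst hv
    have := centerValue_starHist (c := v) henc hQ (Nat.le_add_right Q B)
      (fun u hu => hist_starStrategy henc hQ x (Q + B) u hu) k
    rw [← this]
    exact if_pos rfl
  · have hh : (starStrategy enc Q c).hist x (starStrategy enc Q c).rounds s(v, c)
        = starHist enc Q x v (Q + B) := by
      rw [Sym2.eq_swap]; exact hist_starStrategy henc hQ x (Q + B) v hv
    have hx : ∀ u, (x u k : ℕ) ≤ m u := fun u => Nat.lt_succ_iff.1 (x u k).2
    have h₁ := sum_le_add_others hx v
    have h₂ := Finset.single_le_sum (f := fun u => (x u k : ℕ)) (fun i _ => Nat.zero_le _)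
      (Finset.mem_univ v)
    have hdec : (starStrategy enc Q c).decode v (x v)
        (fun u => (starStrategy enc Q c).hist x (starStrategy enc Q c).rounds s(v, u)) k
        = if θ ≤ x v k then true else if (x v k : ℕ) + others m v < θ then false
          else ((starHist enc Q x v (Q + B)).reverse[Q + k]?).join.getD false := by
      rw [← hh]
      exact if_neg hv
    rw [hdec]
    split_ifs with h₃ h₄
    · exact (decide_eq_true (h₃.trans h₂)).symm
    · exact (decide_eq_false (by omega)).symm
    · have hu : Unsettled (others m v) θ (clip (others m v) θ (x v k)) :=
        unsettled_clip.2 ⟨not_le.1 h₃, not_lt.1 h₄⟩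
      simp [starHist, starSlot, toWord, hu]

lemma bits_starStrategy_le (henc : ∀ v, PrefixFree (enc v)) (hQ : ∀ v w, (enc v w).length ≤ Q)
    (x : Input m B) {v : V} (hv : v ≠ c) :
    (starStrategy enc Q c).bits x s(c, v)
      ≤ (enc v (toWord θ (x v))).length + replies (toWord θ (x v)) := by
  have h₁ : (starStrategy enc Q c).bits x s(c, v)
      = (starHist enc Q x v (Q + B)).countP Option.isSome := by
    rw [← hist_starStrategy henc hQ x (Q + B) v hv]; rfl
  rw [h₁, starHist, List.countP_reverse, List.range_add, List.map_append, List.countP_append]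
  refine add_le_add ?_ (le_of_eq ?_)
  · have h := toBits_starHist_of_le (enc := enc) (x := x) v (le_refl Q)
    rw [List.take_of_length_le (hQ _ _), starHist, History.toBits, List.reverse_reverse] at h
    rw [← h, List.countP_eq_length_filter, List.reduceOption_length_eq]
  · rw [← List.map_coe_finRange_eq_range, List.map_map, List.map_map, List.countP_map, replies]
    rw [List.countP_eq_length_filter,
      ← List.toFinset_card_of_nodup ((List.nodup_finRange B).filter _)]
    congr 1
    ext k
    by_cases h : Unsettled (others m v) θ (toWord θ (x v) k) <;> simp [starSlot, h]

lemma bits_starStrategy_eq_zero (x : Input m B) {e : Sym2 V} (he : leafOf c e = c) :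
    (starStrategy enc Q c).bits x e = 0 := by
  have : ∀ t, ((starStrategy enc Q c).hist x t e).countP Option.isSome = 0 := by
    intro t
    induction t with
    | zero => rfl
    | succ t ih =>
      have hsp : (starStrategy enc Q c).speaker e ((starStrategy enc Q c).hist x t e) = none :=
        if_pos he
      rw [Strategy.hist]
      beta_reduce
      rw [hsp, List.countP_cons, ih]
      rfl
  exact this _

end Star

theorem exists_star_strategy (m : V → ℕ) (θ B : ℕ) (c : V) :
    ∃ S : Strategy (SimpleGraph.starGraph c) m B, S.Computes θ ∧
      (∀ v, v ≠ c → 2 ^ S.worstBits s(c, v)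
        ≤ 4 * (B + 1) * cutSize (m v) (others m v) θ ^ B) ∧
      ∀ e, leafOf c e = c → S.worstBits e = 0 := by
  choose enc henc hlen using fun v : V => exists_prefixFree_alphabet (m v) (others m v) θ B
  -- Idle slots are free, so any common bound on the codeword lengths will do.
  obtain ⟨Q, hQ⟩ : ∃ Q, ∀ v w, (enc v w).length ≤ Q :=
    ⟨Finset.univ.sup fun v => Finset.univ.sup fun w => (enc v w).length, fun v w =>
      (Finset.le_sup (f := fun w => (enc v w).length) (Finset.mem_univ w)).trans
        (Finset.le_sup (f := fun v => Finset.univ.sup fun w => (enc v w).length)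
          (Finset.mem_univ v))⟩
  refine ⟨starStrategy enc Q c, computes_starStrategy henc hQ c, fun v hv => ?_, fun e he => ?_⟩
  · obtain ⟨x, -, hx⟩ := Finset.exists_mem_eq_sup (Finset.univ : Finset (Input m B))
      ⟨fun _ _ => 0, Finset.mem_univ _⟩ fun x => (starStrategy enc Q c).bits x s(c, v)
    rw [Strategy.worstBits, hx]
    exact (Nat.pow_le_pow_right two_pos (bits_starStrategy_le henc hQ x hv)).trans (hlen v _)
  · exact Nat.le_zero.1 (Finset.sup_le fun x _ => (bits_starStrategy_eq_zero x he).le)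

/-! ### The two-node complexity in closed form -/

/-- The complexity of the two-node problem, in closed form. -/
def cutRate (a b θ : ℕ) : ℝ := Real.logb 2 (cutSize a b θ)

lemma cutRate_nonneg (a b θ : ℕ) : 0 ≤ cutRate a b θ :=
  Real.logb_nonneg one_lt_two (by exact_mod_cast cutSize_pos a b θ)

lemma mul_cutRate_le {a b θ B w : ℕ} (h : cutSize a b θ ^ B ≤ 2 ^ w) :
    B * cutRate a b θ ≤ w := by
  have hN : (0 : ℝ) < cutSize a b θ := by exact_mod_cast cutSize_pos a b θ
  have h' : ((cutSize a b θ : ℝ)) ^ B ≤ 2 ^ w := by exact_mod_cast h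
  have := Real.logb_le_logb_of_le one_lt_two (by positivity) h'
  rwa [Real.logb_pow, Real.logb_pow, Real.logb_self_eq_one one_lt_two, mul_one] at this

lemma le_logb_add_mul_cutRate {a b θ B w : ℕ} (h : 2 ^ w ≤ 4 * (B + 1) * cutSize a b θ ^ B) :
    (w : ℝ) ≤ Real.logb 2 (4 * (B + 1)) + B * cutRate a b θ := by
  have hN : (0 : ℝ) < cutSize a b θ := by exact_mod_cast cutSize_pos a b θ
  have h' : (2 : ℝ) ^ w ≤ 4 * (B + 1) * (cutSize a b θ : ℝ) ^ B := by exact_mod_cast h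
  have := Real.logb_le_logb_of_le one_lt_two (by positivity) h'
  rwa [Real.logb_pow, Real.logb_mul (by positivity) (by positivity), Real.logb_pow,
    Real.logb_self_eq_one one_lt_two, mul_one] at this

lemma eventually_logb_le {ε : ℝ} (hε : 0 < ε) :
    ∀ᶠ B : ℕ in atTop, Real.logb 2 (4 * ((B : ℝ) + 1)) ≤ ε * B := by
  have hlog : 0 < Real.log 2 := Real.log_pos one_lt_two
  have hc : 0 < ε * Real.log 2 / 8 := by positivity
  have htend : Tendsto (fun B : ℕ => 4 * ((B : ℝ) + 1)) atTop atTop :=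
    (tendsto_atTop_add_const_right _ _ tendsto_natCast_atTop_atTop).const_mul_atTop (by norm_num)
  filter_upwards [htend.eventually (Real.isLittleO_log_id_atTop.bound hc), eventually_ge_atTop 1]
    with B hB hB1
  have hB1' : (1 : ℝ) ≤ B := by exact_mod_cast hB1
  have h₁ : Real.log (4 * ((B : ℝ) + 1)) ≤ ε * Real.log 2 / 8 * (4 * ((B : ℝ) + 1)) := by
    refine (le_abs_self _).trans (hB.trans (le_of_eq ?_))
    rw [id, Real.norm_of_nonneg (by positivity)]
  rw [Real.logb, div_le_iff₀ hlog]
  refine h₁.trans ?_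
  have : 4 * ((B : ℝ) + 1) ≤ 8 * B := by linarith
  calc ε * Real.log 2 / 8 * (4 * ((B : ℝ) + 1)) ≤ ε * Real.log 2 / 8 * (8 * B) := by gcongr
    _ = ε * B * Real.log 2 := by ring

/-- Aggregation along a star attains the cut-set bound on every edge of the star. -/
theorem eventually_star_strategy (m : V → ℕ) (θ : ℕ) (c : V) {ε : ℝ} (hε : 0 < ε) :
    ∀ᶠ B : ℕ in atTop, ∃ S : Strategy (SimpleGraph.starGraph c) m B, S.Computes θ ∧
      (∀ v, v ≠ c → (S.worstBits s(c, v) : ℝ) ≤ B * (cutRate (m v) (others m v) θ + ε)) ∧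
      ∀ e, leafOf c e = c → S.worstBits e = 0 := by
  filter_upwards [eventually_logb_le hε] with B hB
  obtain ⟨S, hS, hv, h0⟩ := exists_star_strategy m θ B c
  refine ⟨S, hS, fun v hvc => ?_, h0⟩
  have := le_logb_add_mul_cutRate (hv v hvc)
  linarith

lemma sum_compl_singleton_zero (m₁ m₂ : ℕ) :
    ∑ i ∈ ({0} : Finset (Fin 2))ᶜ, (![m₁, m₂] : Fin 2 → ℕ) i = m₂ := by
  rw [show ({0} : Finset (Fin 2))ᶜ = {1} by decide, Finset.sum_singleton]; rfl

/-- The strategy `S₀` makes the set of costs nonempty, so that its infimum is attained rather than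
the default value `0`. -/
lemma mul_cutRate_le_twoNodeBits {m₁ m₂ θ B : ℕ}
    (S₀ : Strategy (⊤ : SimpleGraph (Fin 2)) ![m₁, m₂] B) (hS₀ : S₀.Computes θ) :
    B * cutRate m₁ m₂ θ ≤ twoNodeBits m₁ m₂ θ B := by
  obtain ⟨S, hS, hw⟩ := Nat.sInf_mem (s := {c | ∃ S : Strategy (⊤ : SimpleGraph (Fin 2))
    ![m₁, m₂] B, S.Computes θ ∧ S.worstBits s(0, 1) = c}) ⟨_, S₀, hS₀, rfl⟩
  have hcut : ∀ a ∈ ({0} : Finset (Fin 2)), ∀ b ∉ ({0} : Finset (Fin 2)),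
      (⊤ : SimpleGraph (Fin 2)).Adj a b → s(a, b) = s(0, 1) := by
    intro a ha b hb _
    have hb' : b = 1 := by rw [Finset.mem_singleton] at hb; omega
    rw [Finset.mem_singleton.1 ha, hb']
  have := S.cutSize_pow_le hS hcut (u := 0) (w := 1) (by simp) (by simp)
  rw [hw, Finset.sum_singleton, sum_compl_singleton_zero] at this
  exact mul_cutRate_le this

/-- The complexity of the two-node problem. -/
theorem twoNodeComplexity_eq (m₁ m₂ θ : ℕ) : twoNodeComplexity m₁ m₂ θ = cutRate m₁ m₂ θ := by
  refine Tendsto.limsup_eq (Metric.tendsto_nhds.2 fun ε hε => ?_)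
  filter_upwards [eventually_star_strategy ![m₁, m₂] θ 1 (half_pos hε), eventually_gt_atTop 0]
    with B hB hB0
  -- The center is node 1, so the leaf is node 0 and the rate is `cutRate m₁ m₂ θ` in this order; no
  -- symmetry of `cutRate` is needed.
  have htop : SimpleGraph.starGraph (1 : Fin 2) = ⊤ := by
    ext a b
    simp only [SimpleGraph.starGraph_adj, SimpleGraph.top_adj, ne_eq]
    omega
  rw [htop] at hB
  obtain ⟨S, hS, hw, -⟩ := hB
  have hw' := hw 0 (by decide)
  rw [others, sum_compl_singleton_zero, Sym2.eq_swap] at hw'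
  have h₁ := mul_cutRate_le_twoNodeBits S hS
  have h₂ : (twoNodeBits m₁ m₂ θ B : ℝ) ≤ S.worstBits s(0, 1) := by
    exact_mod_cast Nat.sInf_le (show S.worstBits s(0, 1) ∈ {c | ∃ S : Strategy
      (⊤ : SimpleGraph (Fin 2)) ![m₁, m₂] B, S.Computes θ ∧ S.worstBits s(0, 1) = c} from
        ⟨S, hS, rfl⟩)
  have hB0' : (0 : ℝ) < B := by exact_mod_cast hB0
  have h₃ : cutRate m₁ m₂ θ ≤ (twoNodeBits m₁ m₂ θ B : ℝ) / B := by
    rw [le_div_iff₀ hB0']; linarith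
  have h₄ : (twoNodeBits m₁ m₂ θ B : ℝ) / B ≤ cutRate m₁ m₂ θ + ε / 2 := by
    rw [div_le_iff₀ hB0', mul_comm]; exact h₂.trans hw'
  rw [Real.dist_eq, abs_lt]
  constructor <;> linarith

/-! ### Symmetric rates on the complete graph -/

section TreeRates

variable {m : V → ℕ} {θ : ℕ}

lemma nonneg_of_mem_achievableRates {T : SimpleGraph V} {R : Sym2 V → ℝ}
    (hR : R ∈ achievableRates T m θ) (e : Sym2 V) : 0 ≤ R e := by
  refine le_of_forall_pos_le_add fun ε hε => ?_
  obtain ⟨B, ⟨S, -, hw⟩, hB⟩ := ((hR ε hε).and (eventually_gt_atTop 0)).exists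
  have hB' : (0 : ℝ) < B := by exact_mod_cast hB
  exact nonneg_of_mul_nonneg_right ((Nat.cast_nonneg _).trans (hw e)) hB'

lemma cutRate_le_of_mem_achievableRates {T : SimpleGraph V} {R : Sym2 V → ℝ}
    (hR : R ∈ achievableRates T m θ) {A : Finset V} {e : Sym2 V}
    (hcut : ∀ a ∈ A, ∀ b ∉ A, T.Adj a b → s(a, b) = e) {u w : V} (hu : u ∈ A) (hw : w ∉ A) :
    cutRate (∑ i ∈ A, m i) (∑ i ∈ Aᶜ, m i) θ ≤ R e := by
  refine le_of_forall_pos_le_add fun ε hε => ?_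
  obtain ⟨B, ⟨S, hS, hb⟩, hB⟩ := ((hR ε hε).and (eventually_gt_atTop 0)).exists
  have hB' : (0 : ℝ) < B := by exact_mod_cast hB
  exact le_of_mul_le_mul_left ((mul_cutRate_le (S.cutSize_pow_le hS hcut hu hw)).trans (hb e)) hB'

open Classical in
-- Every tree edge is a bridge: take for `A` the component of one endpoint after its deletion.
lemma exists_cut_of_isTree {T : SimpleGraph V} (hT : T.IsTree) {e : Sym2 V}
    (he : e ∈ T.edgeSet) :
    ∃ (A : Finset V) (u w : V), u ∈ A ∧ w ∉ A ∧ ∀ a ∈ A, ∀ b ∉ A, T.Adj a b → s(a, b) = e := by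
  have hb := SimpleGraph.isAcyclic_iff_forall_isBridge.1 hT.isAcyclic he
  induction e with | _ u w
  rw [SimpleGraph.isBridge_iff] at hb
  refine ⟨Finset.univ.filter fun v => (T.deleteEdges {s(u, w)}).Reachable u v, u, w, ?_, ?_, ?_⟩
  · simp
  · simpa using hb
  · intro a ha b hb' hab
    simp only [Finset.mem_filter, Finset.mem_univ, true_and] at ha hb'
    by_contra hne
    refine hb' (ha.trans (SimpleGraph.Adj.reachable ?_))
    rw [SimpleGraph.deleteEdges_adj]
    exact ⟨hab, hne⟩

lemma cutRate_one {a b : ℕ} (ha : 1 ≤ a) (hb : 1 ≤ b) : cutRate a b 1 = Real.logb 2 3 := by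
  rw [cutRate, cutSize_one ha hb]; norm_num

lemma one_le_sum (hm : ∀ i, 1 ≤ m i) {A : Finset V} (hA : A.Nonempty) : 1 ≤ ∑ i ∈ A, m i :=
  hA.elim fun i hi => (hm i).trans (Finset.single_le_sum (fun _ _ => Nat.zero_le _) hi)

lemma logb_three_le_of_isTree (hm : ∀ i, 1 ≤ m i) {T : SimpleGraph V} (hT : T.IsTree)
    {R : Sym2 V → ℝ} (hR : R ∈ achievableRates T m 1) {e : Sym2 V} (he : e ∈ T.edgeSet) :
    Real.logb 2 3 ≤ R e := by
  obtain ⟨A, u, w, hu, hw, hcut⟩ := exists_cut_of_isTree hT he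
  rw [← cutRate_one (one_le_sum hm ⟨u, hu⟩) (one_le_sum hm ⟨w, Finset.mem_compl.2 hw⟩)]
  exact cutRate_le_of_mem_achievableRates hR hcut hu hw

/-- For threshold one, each of the edges of a spanning tree has rate at least `log₂ 3`. -/
lemma le_sum_of_mem_treeRates (hm : ∀ i, 1 ≤ m i) {R : Sym2 V → ℝ}
    (hR : R ∈ treeRates (⊤ : SimpleGraph V) m 1) :
    ((Fintype.card V : ℝ) - 1) * Real.logb 2 3
      ≤ ∑ e ∈ (⊤ : SimpleGraph V).edgeFinset, R e := by
  classical
  -- The bound is a half-space, so it suffices to check it on each single tree.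
  have hconv : Convex ℝ {R : Sym2 V → ℝ | ((Fintype.card V : ℝ) - 1) * Real.logb 2 3
      ≤ ∑ e ∈ (⊤ : SimpleGraph V).edgeFinset, R e} := by
    refine convex_halfSpace_ge ⟨fun x y => ?_, fun c x => ?_⟩ _
    · simp [Finset.sum_add_distrib]
    · simp [Finset.mul_sum]
  refine convexHull_min (Set.iUnion₂_subset fun T hT R hR => ?_) hconv hR
  have hcard : (T.edgeFinset.card : ℝ) + 1 = Fintype.card V := by
    exact_mod_cast hT.2.card_edgeFinset
  calc ((Fintype.card V : ℝ) - 1) * Real.logb 2 3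
      = ∑ e ∈ T.edgeFinset, Real.logb 2 3 := by
        rw [Finset.sum_const, nsmul_eq_mul, ← hcard]; ring
    _ ≤ ∑ e ∈ T.edgeFinset, R e := Finset.sum_le_sum fun e he =>
        logb_three_le_of_isTree hm hT.2 hR (SimpleGraph.mem_edgeFinset.1 he)
    _ ≤ ∑ e ∈ (⊤ : SimpleGraph V).edgeFinset, R e :=
        Finset.sum_le_sum_of_subset_of_nonneg (SimpleGraph.edgeFinset_mono hT.1)
          fun e _ _ => nonneg_of_mem_achievableRates hR e

lemma nonneg_of_mem_treeRates {G : SimpleGraph V} {R : Sym2 V → ℝ} (hR : R ∈ treeRates G m θ)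
    (e : Sym2 V) : 0 ≤ R e := by
  have hconv : Convex ℝ {R : Sym2 V → ℝ | 0 ≤ R e} :=
    convex_halfSpace_ge ⟨fun _ _ => rfl, fun _ _ => rfl⟩ _
  exact convexHull_min (Set.iUnion₂_subset fun T _ R hR => nonneg_of_mem_achievableRates hR e)
    hconv hR

lemma star_mem_achievableRates {L : ℝ} (hL : ∀ v, cutRate (m v) (others m v) θ = L) (c : V) :
    (fun e => if leafOf c e = c then 0 else L)
      ∈ achievableRates (SimpleGraph.starGraph c) m θ := by
  intro ε hε
  filter_upwards [eventually_star_strategy m θ c hε] with B hB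
  obtain ⟨S, hS, hv, h0⟩ := hB
  refine ⟨S, hS, fun e => ?_⟩
  split_ifs with h
  · rw [h0 e h]; simp; positivity
  · have := hv _ h
    rwa [hL, ← eq_mk_leafOf h] at this

lemma leafOf_ne_iff {c u v : V} (huv : u ≠ v) : leafOf c s(u, v) ≠ c ↔ c = u ∨ c = v := by
  constructor
  · intro h
    have hc : c ∈ s(c, leafOf c s(u, v)) := Sym2.mem_mk_left _ _
    rw [← eq_mk_leafOf h] at hc
    simpa using hc
  · rintro (rfl | rfl)
    · rw [leafOf_mk]; exact huv.symm
    · rw [Sym2.eq_swap, leafOf_mk]; exact huv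

/-- Time-sharing between all stars. -/
lemma two_div_card_mem_symmetricRates [Nonempty V] {L : ℝ}
    (hL : ∀ v, cutRate (m v) (others m v) θ = L) :
    2 / (Fintype.card V : ℝ) * L ∈ symmetricRates (⊤ : SimpleGraph V) (treeRates ⊤ m θ) := by
  have hn : (0 : ℝ) < Fintype.card V := by exact_mod_cast Fintype.card_pos
  refine ⟨∑ c : V, (1 / (Fintype.card V : ℝ)) • fun e => if leafOf c e = c then 0 else L,
    (convex_convexHull ℝ _).sum_mem (fun _ _ => by positivity) ?_ fun c _ =>
      subset_convexHull ℝ _ (Set.mem_iUnion₂.2 ⟨SimpleGraph.starGraph c,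
        ⟨le_top, SimpleGraph.isTree_starGraph c⟩, star_mem_achievableRates hL c⟩), ?_⟩
  · rw [Finset.sum_const, nsmul_eq_mul, Finset.card_univ]; field_simp
  · intro e he
    induction e with | _ u v
    have huv : u ≠ v := he
    -- The edge `s(u, v)` is used only by the stars centered at `u` and at `v`, whence the factor 2.
    have hite : ∀ c : V, (if leafOf c s(u, v) = c then 0 else L)
        = if c ∈ ({u, v} : Finset V) then L else 0 := by
      intro c
      by_cases h : leafOf c s(u, v) = c
      · rw [if_pos h, if_neg]
        rw [Finset.mem_insert, Finset.mem_singleton, ← leafOf_ne_iff huv]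
        exact not_not.2 h
      · rw [if_neg h, if_pos]
        rw [Finset.mem_insert, Finset.mem_singleton]
        exact (leafOf_ne_iff huv).1 h
    simp only [Finset.sum_apply, Pi.smul_apply, smul_eq_mul, hite]
    rw [← Finset.mul_sum, Finset.sum_ite_mem, Finset.univ_inter, Finset.sum_pair huv]
    ring

lemma mem_symmetricRates_cutSetRates {r : ℝ} :
    r ∈ symmetricRates (⊤ : SimpleGraph V) (cutSetRates ⊤ m θ) ↔
      ∀ A : Finset V, A.Nonempty → Aᶜ.Nonempty →
        cutRate (∑ i ∈ A, m i) (∑ i ∈ Aᶜ, m i) θ ≤ A.card * Aᶜ.card * r := by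
  have hsum : ∀ R : Sym2 V → ℝ, (∀ e ∈ (⊤ : SimpleGraph V).edgeSet, R e = r) →
      ∀ (A : Finset V) (inst : ∀ a b, Decidable ((⊤ : SimpleGraph V).Adj a b)),
      (∑ a ∈ A, ∑ b ∈ Aᶜ, if (⊤ : SimpleGraph V).Adj a b then R s(a, b) else 0)
        = A.card * Aᶜ.card * r := by
    intro R hR A inst
    have : ∀ a ∈ A, ∀ b ∈ Aᶜ,
        (if (⊤ : SimpleGraph V).Adj a b then R s(a, b) else 0) = r := fun a ha b hb => by
      have hab : (⊤ : SimpleGraph V).Adj a b := fun h => Finset.mem_compl.1 hb (h ▸ ha)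
      rw [if_pos hab, hR _ hab]
    rw [Finset.sum_congr rfl fun a ha => Finset.sum_congr rfl (this a ha)]
    simp [mul_assoc]
  constructor
  · rintro ⟨R, hR, hr⟩ A hA hA'
    have := hR A hA hA'
    rw [twoNodeComplexity_eq] at this
    exact this.trans (hsum R hr A _).le
  · intro h
    refine ⟨fun _ => r, fun A hA hA' => ?_, fun _ _ => rfl⟩
    rw [twoNodeComplexity_eq]
    exact (h A hA hA').trans (hsum (fun _ => r) (fun _ _ => rfl) A _).ge

lemma bddBelow_symmetricRates_cutSetRates [Nontrivial V] :
    BddBelow (symmetricRates (⊤ : SimpleGraph V) (cutSetRates ⊤ m θ)) := by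
  obtain ⟨u, w, huw⟩ := exists_pair_ne V
  refine ⟨0, fun r hr => ?_⟩
  have hw : w ∈ ({u} : Finset V)ᶜ := by simpa using huw.symm
  have := mem_symmetricRates_cutSetRates.1 hr {u} ⟨u, by simp⟩ ⟨w, hw⟩
  have hpos : (0 : ℝ) < (({u} : Finset V).card : ℝ) * (({u} : Finset V)ᶜ.card : ℝ) := by
    have := Finset.card_pos.2 ⟨w, hw⟩
    rw [Finset.card_singleton]; positivity
  exact nonneg_of_mul_nonneg_right ((cutRate_nonneg _ _ _).trans this) hpos

lemma isLeast_Rcut [Nontrivial V] :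
    IsLeast (symmetricRates (⊤ : SimpleGraph V) (cutSetRates ⊤ m θ))
      (Rcut (⊤ : SimpleGraph V) m θ) := by
  refine IsClosed.isLeast_csInf ?_ ?_ bddBelow_symmetricRates_cutSetRates
  · have : symmetricRates (⊤ : SimpleGraph V) (cutSetRates ⊤ m θ)
        = ⋂ (A : Finset V) (_ : A.Nonempty) (_ : Aᶜ.Nonempty),
          {r : ℝ | cutRate (∑ i ∈ A, m i) (∑ i ∈ Aᶜ, m i) θ ≤ A.card * Aᶜ.card * r} := by
      ext r
      rw [mem_symmetricRates_cutSetRates]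
      simp only [Set.mem_iInter, Set.mem_ofPred_eq]
    rw [this]
    exact isClosed_iInter fun A => isClosed_iInter fun _ => isClosed_iInter fun _ =>
      isClosed_le continuous_const (by fun_prop)
  · set F : Finset V → ℝ := fun A => cutRate (∑ i ∈ A, m i) (∑ i ∈ Aᶜ, m i) θ
    -- Each cut is crossed by at least one edge, so the sum of all cut complexities is a feasible
    -- rate.
    refine ⟨∑ A, F A, mem_symmetricRates_cutSetRates.2 fun A hA hA' => ?_⟩
    have h₁ : F A ≤ ∑ A, F A :=
      Finset.single_le_sum (f := F) (fun _ _ => cutRate_nonneg _ _ _) (Finset.mem_univ A)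
    have h₂ : (1 : ℝ) ≤ A.card := by exact_mod_cast Finset.card_pos.2 hA
    have h₃ : (1 : ℝ) ≤ Aᶜ.card := by exact_mod_cast Finset.card_pos.2 hA'
    have h₄ : (0 : ℝ) ≤ F A := cutRate_nonneg _ _ _
    calc F A ≤ 1 * ∑ A, F A := by rwa [one_mul]
      _ ≤ _ := mul_le_mul_of_nonneg_right (one_le_mul_of_one_le_of_one_le h₂ h₃) (h₄.trans h₁)

lemma bddBelow_symmetricRates_treeRates [Nontrivial V] :
    BddBelow (symmetricRates (⊤ : SimpleGraph V) (treeRates ⊤ m θ)) := by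
  obtain ⟨u, w, huw⟩ := exists_pair_ne V
  refine ⟨0, ?_⟩
  rintro r ⟨R, hR, hr⟩
  rw [← hr s(u, w) huw]
  exact nonneg_of_mem_treeRates hR _

lemma cutRate_le_card_mul_Rcut [Nontrivial V] (v : V) :
    cutRate (m v) (others m v) θ
      ≤ ((Fintype.card V : ℝ) - 1) * Rcut (⊤ : SimpleGraph V) m θ := by
  obtain ⟨w, hw⟩ := exists_ne v
  have := mem_symmetricRates_cutSetRates.1 (isLeast_Rcut (m := m) (θ := θ)).1 {v} ⟨v, by simp⟩
    ⟨w, by simpa using hw⟩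
  rw [Finset.sum_singleton, Finset.card_singleton, Finset.card_compl, Finset.card_singleton,
    Nat.cast_sub Fintype.card_pos, Nat.cast_one, one_mul] at this
  exact this

lemma isGLB_Rach [Nontrivial V] {L : ℝ} (hL : ∀ v, cutRate (m v) (others m v) θ = L) :
    IsGLB (symmetricRates (⊤ : SimpleGraph V) (treeRates ⊤ m θ))
      (Rach (⊤ : SimpleGraph V) m θ) :=
  isGLB_csInf ⟨_, two_div_card_mem_symmetricRates hL⟩ bddBelow_symmetricRates_treeRates

/-- Splits the constant into the `2 / N` of star time-sharing and the `N - 1` edges across a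
singleton cut. -/
lemma two_mul_one_sub_mul {N : ℝ} (hN : N ≠ 0) (r : ℝ) :
    2 * (1 - 1 / N) * r = 2 / N * ((N - 1) * r) := by
  field_simp

theorem Rach_le [Nontrivial V] {L : ℝ} (hL : ∀ v, cutRate (m v) (others m v) θ = L) :
    Rach (⊤ : SimpleGraph V) m θ
      ≤ 2 * (1 - 1 / (Fintype.card V : ℝ)) * Rcut (⊤ : SimpleGraph V) m θ := by
  obtain ⟨v⟩ := (inferInstance : Nonempty V)
  have hn : (0 : ℝ) < Fintype.card V := by exact_mod_cast Fintype.card_pos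
  rw [two_mul_one_sub_mul hn.ne']
  refine ((isGLB_Rach hL).1 (two_div_card_mem_symmetricRates hL)).trans ?_
  rw [← hL v]
  exact mul_le_mul_of_nonneg_left (cutRate_le_card_mul_Rcut v) (by positivity)

/-- Amounts to `(|A| - 1) * (|Aᶜ| - 1) ≥ 0`: singleton cuts have the fewest edges. -/
lemma card_sub_one_le_card_mul_card_compl {A : Finset V} (hA : A.Nonempty) (hA' : Aᶜ.Nonempty) :
    (Fintype.card V : ℝ) - 1 ≤ A.card * Aᶜ.card := by
  have h₁ : (A.card : ℝ) + Aᶜ.card = Fintype.card V := by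
    exact_mod_cast Finset.card_add_card_compl A
  have h₂ : (1 : ℝ) ≤ A.card := by exact_mod_cast Finset.card_pos.2 hA
  have h₃ : (1 : ℝ) ≤ Aᶜ.card := by exact_mod_cast Finset.card_pos.2 hA'
  nlinarith

lemma card_mul_Rcut_one_le [Nontrivial V] (hm : ∀ i, 1 ≤ m i) :
    ((Fintype.card V : ℝ) - 1) * Rcut (⊤ : SimpleGraph V) m 1 ≤ Real.logb 2 3 := by
  have hn : (1 : ℝ) < Fintype.card V := by exact_mod_cast Fintype.one_lt_card
  have hn' : 0 < (Fintype.card V : ℝ) - 1 := by linarith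
  have hL : 0 ≤ Real.logb 2 3 := Real.logb_nonneg one_lt_two (by norm_num)
  rw [mul_comm, ← le_div_iff₀ hn']
  refine (isLeast_Rcut (m := m) (θ := 1)).2
    (mem_symmetricRates_cutSetRates.2 fun A hA hA' => ?_)
  rw [cutRate_one (one_le_sum hm hA) (one_le_sum hm hA'), mul_div_assoc', le_div_iff₀ hn',
    mul_comm]
  exact mul_le_mul_of_nonneg_right (card_sub_one_le_card_mul_card_compl hA hA') hL

lemma two_div_card_mul_logb_le_Rach [Nontrivial V] {L : ℝ} (hm : ∀ i, 1 ≤ m i)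
    (hL : ∀ v, cutRate (m v) (others m v) 1 = L) :
    2 / (Fintype.card V : ℝ) * Real.logb 2 3 ≤ Rach (⊤ : SimpleGraph V) m 1 := by
  have hn : (1 : ℝ) < Fintype.card V := by exact_mod_cast Fintype.one_lt_card
  have hn' : 0 < (Fintype.card V : ℝ) - 1 := by linarith
  refine (isGLB_Rach hL).2 ?_
  rintro r ⟨R, hR, hr⟩
  have h := le_sum_of_mem_treeRates hm hR
  rw [Finset.sum_congr rfl fun e he => hr e (SimpleGraph.mem_edgeFinset.1 he), Finset.sum_const,
    SimpleGraph.card_edgeFinset_top_eq_card_choose_two, nsmul_eq_mul, Nat.cast_choose_two] at h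
  have h' : ((Fintype.card V : ℝ) - 1) * Real.logb 2 3
      ≤ ((Fintype.card V : ℝ) - 1) * (Fintype.card V * r / 2) := h.trans (le_of_eq (by ring))
  have h'' := le_of_mul_le_mul_left h' hn'
  rw [div_mul_eq_mul_div, div_le_iff₀ (by linarith)]
  linarith

theorem Rach_one_eq [Nontrivial V] {L : ℝ} (hm : ∀ i, 1 ≤ m i)
    (hL : ∀ v, cutRate (m v) (others m v) 1 = L) :
    Rach (⊤ : SimpleGraph V) m 1
      = 2 * (1 - 1 / (Fintype.card V : ℝ)) * Rcut (⊤ : SimpleGraph V) m 1 := by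
  have hn : (0 : ℝ) < Fintype.card V := by exact_mod_cast Fintype.card_pos
  refine le_antisymm (Rach_le hL) ?_
  rw [two_mul_one_sub_mul hn.ne']
  exact (mul_le_mul_of_nonneg_left (card_mul_Rcut_one_le hm) (by positivity)).trans
    (two_div_card_mul_logb_le_Rach hm hL)

lemma Rcut_one_pos [Nontrivial V] (hm : ∀ i, 1 ≤ m i) : 0 < Rcut (⊤ : SimpleGraph V) m 1 := by
  obtain ⟨v, w, hvw⟩ := exists_pair_ne V
  have h := cutRate_le_card_mul_Rcut (m := m) (θ := 1) v
  rw [others, cutRate_one (hm v) (one_le_sum hm ⟨w, by simpa using hvw.symm⟩)] at h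
  have hn : (1 : ℝ) < Fintype.card V := by exact_mod_cast Fintype.one_lt_card
  exact pos_of_mul_pos_right ((Real.logb_pos one_lt_two (by norm_num)).trans_le h) (by linarith)

end TreeRates

lemma cutRate_others_const (l θ : ℕ) (v : V) :
    cutRate l (others (fun _ => l) v) θ = cutRate l ((Fintype.card V - 1) * l) θ := by
  simp [others, Finset.card_compl]

end SumThreshold

end

theorem mainTheorem7 (n : ℕ) (hn : 2 ≤ n) :
    (∀ l θ : ℕ, 1 ≤ l →
      IsGLB (SumThreshold.symmetricRates (⊤ : SimpleGraph (Fin n))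
          (SumThreshold.treeRates ⊤ (fun _ => l - 1) θ))
        (SumThreshold.Rach (⊤ : SimpleGraph (Fin n)) (fun _ => l - 1) θ) ∧
      IsLeast (SumThreshold.symmetricRates (⊤ : SimpleGraph (Fin n))
          (SumThreshold.cutSetRates ⊤ (fun _ => l - 1) θ))
        (SumThreshold.Rcut (⊤ : SimpleGraph (Fin n)) (fun _ => l - 1) θ) ∧
      SumThreshold.Rach (⊤ : SimpleGraph (Fin n)) (fun _ => l - 1) θ
        ≤ 2 * (1 - 1 / (n : ℝ)) *
          SumThreshold.Rcut (⊤ : SimpleGraph (Fin n)) (fun _ => l - 1) θ) ∧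
    (∀ l : ℕ, 2 ≤ l → ∃ θ : ℕ,
      0 < SumThreshold.Rcut (⊤ : SimpleGraph (Fin n)) (fun _ => l - 1) θ ∧
      SumThreshold.Rach (⊤ : SimpleGraph (Fin n)) (fun _ => l - 1) θ
        = 2 * (1 - 1 / (n : ℝ)) *
          SumThreshold.Rcut (⊤ : SimpleGraph (Fin n)) (fun _ => l - 1) θ) := by
  have : Nontrivial (Fin n) := Fin.nontrivial_iff_two_le.2 hn
  refine ⟨fun l θ _ => ⟨SumThreshold.isGLB_Rach (SumThreshold.cutRate_others_const (l - 1) θ),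
    SumThreshold.isLeast_Rcut, ?_⟩, fun l hl => ⟨1, SumThreshold.Rcut_one_pos fun _ => by omega, ?_⟩⟩
  · simpa using SumThreshold.Rach_le (SumThreshold.cutRate_others_const (V := Fin n) (l - 1) θ)
  · simpa using SumThreshold.Rach_one_eq (fun _ => by omega)
      (SumThreshold.cutRate_others_const (V := Fin n) (l - 1) 1)
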